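/- Let $\mathbb H$ be the real quaternions, regard $\mathbb C=\mathbb R+\mathbb R\mathbf i\subset\mathbb H$, and let $\mathrm{GL}(n,\mathbb H)$ act on $\mathfrak{gl}(n,\mathbb H)=\mathrm M(n,\mathbb H)$ by conjugation. Call $X\in\mathfrak{gl}(n,\mathbb H)$ $\mathrm{Ad}_{\mathrm{GL}(n,\mathbb H)}$-real if $gXg^{-1}=-X$ for some $g\in\mathrm{GL}(n,\mathbb H)$, and strongly $\mathrm{Ad}_{\mathrm{GL}(n,\mathbb H)}$-real if $\tau X\tau^{-1}=-X$ for some $\tau\in\mathrm{GL}(n,\mathbb H)$ with $\tau^2=\mathrm I_n$. Write $\mathrm J(\lambda,m)$ for the $m\times m$ matrix with $\lambda$ on the diagonal, $1$ on the super-diagonal and $0$ elsewhere. A Jordan decomposition of $A$ is $$SAS^{-1}=\mathrm J(\lambda_1,m_1)\oplus\cdots\oplus\mathrm J(\lambda_k,m_k),$$ where $S\in\mathrm{GL}(n,\mathbb H)$, $m_l\ge 1$, and the $\lambda_l$ are (not necessarily distinct) complex numbers with non-negative imaginary part. Every $A\in\mathfrak{gl}(n,\mathbb H)$ has such a decomposition,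 and its blocks are uniquely determined by $A$ up to permutation. **Theorem.** Let $A\in\mathfrak{gl}(n,\mathbb H)$ be $\mathrm{Ad}_{\mathrm{GL}(n,\mathbb H)}$-real. Suppose that in the Jordan decomposition of $A$, for every non-zero purely imaginary $\mu\in\mathbb C$ and every $m$, the number of indices $l$ with $(\lambda_l,m_l)=(\mu,m)$ is even. Then $A$ is strongly $\mathrm{Ad}_{\mathrm{GL}(n,\mathbb H)}$-real. -/

import Mathlib

open scoped Quaternion

noncomputable section

/-- The Lie algebra `gl(n, ℍ)`, identified with the algebra of `n × n` matrices over Hamilton's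
quaternions. -/
abbrev GlH (n : ℕ) : Type := Matrix (Fin n) (Fin n) ℍ[ℝ]

/-- The group `GL(n, ℍ)` of invertible `n × n` quaternionic matrices. -/
abbrev GroupGLH (n : ℕ) : Type := (GlH n)ˣ

/-- The adjoint action `Ad(g) X = g X g⁻¹` of `GL(n, ℍ)` on `gl(n, ℍ)`. -/
def adjointAction {n : ℕ} (g : GroupGLH n) (X : GlH n) : GlH n :=
  (g : GlH n) * X * ((g⁻¹ : GroupGLH n) : GlH n)

/-- `X` is `Ad`-real: `-X = g X g⁻¹` for some `g` in `GL(n, ℍ)`. -/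
def IsAdReal {n : ℕ} (X : GlH n) : Prop :=
  ∃ g : GroupGLH n, -X = adjointAction g X

/-- `X` is strongly `Ad`-real: `-X = τ X τ⁻¹` for some `τ` in `GL(n, ℍ)` of order at most two. -/
def IsStronglyAdReal {n : ℕ} (X : GlH n) : Prop :=
  ∃ τ : GroupGLH n, τ * τ = 1 ∧ -X = adjointAction τ X

/-- The Jordan block `J(a, m)`: `a` on the diagonal, `1` on the super-diagonal, `0` elsewhere. -/
def jordanBlock (a : ℍ[ℝ]) (m : ℕ) : Matrix (Fin m) (Fin m) ℍ[ℝ] :=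
  Matrix.of fun i j => if i = j then a else if (i : ℕ) + 1 = (j : ℕ) then 1 else 0

/-- A Jordan decomposition `S A S⁻¹ = J(lam 0, size 0) ⊕ ⋯ ⊕ J(lam (k-1), size (k-1))` of a
quaternionic matrix `A`, where the `lam l` are complex numbers with non-negative imaginary part
(regarded as quaternions, the complex unit being the quaternion `i`) and are not necessarily
distinct. Each `lam l` is thus the unique such representative of its class of right eigenvalues. -/
structure JordanDecomposition {n : ℕ} (A : GlH n) where
  /-- The number of blocks. -/
  k : ℕ
  /-- The complex representative of the eigenvalue class of each block. -/
  lam : Fin k → ℂ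
  /-- The size of each block. -/
  size : Fin k → ℕ
  size_pos : ∀ l, 0 < size l
  im_nonneg : ∀ l, 0 ≤ (lam l).im
  /-- A numbering by `Fin n` of the rows of the block diagonal matrix. Another choice permutes
  rows and columns simultaneously, that is, changes `S` by a permutation matrix. -/
  rows : (Σ l, Fin (size l)) ≃ Fin n
  /-- The change of basis. -/
  S : GroupGLH n
  eq_form : adjointAction S A = Matrix.reindex rows rows
    (Matrix.blockDiagonal' fun l => jordanBlock (lam l : ℍ[ℝ]) (size l))

/-- The multiplicity of `J(μ, m)` in a Jordan decomposition: the number of its blocks that are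
equal to `J(μ, m)`. -/
def JordanDecomposition.multiplicity {n : ℕ} {A : GlH n} (D : JordanDecomposition A)
    (μ : ℂ) (m : ℕ) : ℕ :=
  Nat.card {l : Fin D.k // D.lam l = μ ∧ D.size l = m}

end

/-! Conjugate `A` to its Jordan matrix `B`, and let `G` be an invertible matrix with `G B = -B G`.
As in Sylvester's equation, an entry of `G` vanishes unless its row and column eigenvalues have
opposite real parts. So `G` carries the part with positive real parts onto the part with negative
real parts, and acting by `G` on the former and by `G⁻¹` on the latter gives an involution that
anticommutes with `B` there (`exists_involution_of_swap`).

On blocks with real part zero an involution is written down explicitly. Alternating signs reverse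
the super-diagonal. For eigenvalue `0` this suffices. For a non-zero imaginary `μ` the quaternion
`j` reverses the diagonal, but `j² = -1`; swapping equal blocks in pairs, with weights `j` and `-j`,
restores square `1`. This is where even multiplicity enters
(`jordanMatrix_exists_partial_involution`).

Existence of the Jordan form is also proved, by primary decomposition along the real minimal
polynomial. Its uniqueness plays no role. -/

/-! ### Nilpotent endomorphisms over a division ring. -/

theorem linearIndependent_sum_chains {K V ι₁ ι₂ : Type*} [DivisionRing K] [AddCommGroup V]
    [Module K V]
    {s₁ : ι₁ → ℕ} {s₂ : ι₂ → ℕ} {c₁ : ι₁ → ℕ → V} {c₂ : ι₂ → ℕ → V} {U₁ U₂ : Submodule K V}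
    (h₁ : LinearIndependent K fun p : Σ l, Fin (s₁ l) => c₁ p.1 p.2)
    (h₂ : LinearIndependent K fun p : Σ l, Fin (s₂ l) => c₂ p.1 p.2)
    (hU₁ : Submodule.span K (Set.range fun p : Σ l, Fin (s₁ l) => c₁ p.1 p.2) = U₁)
    (hU₂ : Submodule.span K (Set.range fun p : Σ l, Fin (s₂ l) => c₂ p.1 p.2) = U₂)
    (hd : Disjoint U₁ U₂) :
    LinearIndependent K (fun p : Σ l, Fin (Sum.elim s₁ s₂ l) => Sum.elim c₁ c₂ p.1 p.2) ∧
      Submodule.span K (Set.range fun p : Σ l, Fin (Sum.elim s₁ s₂ l) => Sum.elim c₁ c₂ p.1 p.2) =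
        U₁ ⊔ U₂ := by
  subst hU₁ hU₂
  let e := Equiv.sumSigmaDistrib fun l => Fin (Sum.elim s₁ s₂ l)
  have he : (fun p : Σ l, Fin (Sum.elim s₁ s₂ l) => Sum.elim c₁ c₂ p.1 p.2) =
      Sum.elim (fun p : Σ l, Fin (s₁ l) => c₁ p.1 p.2)
        (fun p : Σ l, Fin (s₂ l) => c₂ p.1 p.2) ∘ e := by
    funext ⟨l, i⟩
    cases l <;> rfl
  rw [he]
  constructor
  · exact (linearIndependent_equiv e).2 (h₁.sum_type h₂ hd)
  · rw [← Submodule.span_union, ← Set.Sum.elim_range]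
    exact congrArg _ (e.surjective.range_comp _)

/-- The matrix `φ (N ^ (j + i) v)` is anti-triangular with `1` on the anti-diagonal. Testing with `j
= m - 1 - i` isolates `a i`: earlier coefficients vanish by induction, later terms contain `N ^ m
v`. -/
theorem eq_zero_of_forall_functional_chain_eq_zero {K V : Type*} [DivisionRing K] [AddCommGroup V]
    [Module K V] (N : Module.End K V) (φ : V →ₗ[K] K) {m : ℕ} {v : V} (hv : (N ^ m) v = 0)
    (hφ : φ ((N ^ (m - 1)) v) = 1) (a : Fin m → K)
    (ha : ∀ j < m, φ ((N ^ j) (∑ i, a i • (N ^ (i : ℕ)) v)) = 0) : a = 0 := by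
  have key : ∀ i : ℕ, ∀ hi : i < m, a ⟨i, hi⟩ = 0 := by
    intro i
    induction i using Nat.strong_induction_on with
    | _ i ih =>
      intro hi
      have h := ha (m - 1 - i) (by omega)
      rw [map_sum, map_sum, Finset.sum_eq_single ⟨i, hi⟩] at h
      · rw [map_smul, map_smul, ← Module.End.mul_apply, ← pow_add] at h
        have : m - 1 - i + i = m - 1 := by omega
        simpa [this, hφ] using h
      · intro j _ hj
        rcases lt_or_gt_of_ne (fun h => hj (Fin.ext h) : (j : ℕ) ≠ i) with hlt | hgt
        · have := ih j hlt j.2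
          simp [this]
        · rw [map_smul, map_smul, ← Module.End.mul_apply, ← pow_add]
          have : m - 1 - i + j = (m - 1 - i + j - m) + m := by omega
          rw [this, pow_add, Module.End.mul_apply, hv]
          simp
      · simp
  funext i
  exact key i i.2

/-- A chain of maximal length `m` splits off. If `φ` is `1` on its last vector, the vectors of `U`
killed by all `φ ∘ N ^ j` with `j < m` form an `N`-stable complement, to which induction applies.
Stability at `j = m - 1` uses `N ^ m = 0` on `U`. -/
theorem exists_nilpotent_chains {K V : Type*} [DivisionRing K] [AddCommGroup V] [Module K V]
    [FiniteDimensional K V] (N : Module.End K V) (U : Submodule K V) (hU : ∀ u ∈ U, N u ∈ U)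
    (hk : ∃ k, ∀ u ∈ U, (N ^ k) u = 0) :
    ∃ (ι : Type) (_ : Fintype ι) (s : ι → ℕ) (v : ι → V), (∀ l, 0 < s l) ∧
      (∀ l, (N ^ s l) (v l) = 0) ∧
      LinearIndependent K (fun p : Σ l, Fin (s l) => (N ^ (p.2 : ℕ)) (v p.1)) ∧
      Submodule.span K (Set.range fun p : Σ l, Fin (s l) => (N ^ (p.2 : ℕ)) (v p.1)) = U := by
  induction U using WellFoundedLT.induction with
  | _ U ih =>
    classical
    by_cases hbot : U = ⊥
    · refine ⟨Empty, inferInstance, fun _ => 0, fun _ => 0, by simp, by simp,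
        linearIndependent_empty_type, ?_⟩
      rw [Set.range_eq_empty, Submodule.span_empty, hbot]
    set m := Nat.find hk with hm
    have hmU : ∀ u ∈ U, (N ^ m) u = 0 := Nat.find_spec hk
    have hm0 : 0 < m := by
      rw [Nat.pos_iff_ne_zero]
      intro h0
      rw [h0] at hmU
      exact hbot ((Submodule.eq_bot_iff _).2 fun u hu => by simpa using hmU u hu)
    have hmin : ¬ ∀ u ∈ U, (N ^ (m - 1)) u = 0 := Nat.find_min hk (by omega)
    push Not at hmin
    obtain ⟨v, hvU, hv⟩ := hmin
    obtain ⟨φ, -, hφ⟩ := LinearMap.exists_extend_of_notMem (K := K) (p := ⊥) 0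
      (by simpa using hv) (1 : K)
    have hinj := eq_zero_of_forall_functional_chain_eq_zero N φ (hmU v hvU) hφ
    let Φ : V →ₗ[K] (Fin m → K) := LinearMap.pi fun j => φ ∘ₗ (N ^ (j : ℕ))
    have hΦ : ∀ w, Φ w = 0 ↔ ∀ j < m, φ ((N ^ j) w) = 0 := fun w =>
      ⟨fun h j hj => congrFun h ⟨j, hj⟩, fun h => funext fun j => h j j.2⟩
    let L : (Fin m → K) →ₗ[K] V := Fintype.linearCombination K fun i : Fin m => (N ^ (i : ℕ)) v
    have hL : ∀ a, L a = ∑ i, a i • (N ^ (i : ℕ)) v := fun a => rfl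
    have hpow : ∀ i, (N ^ i) v ∈ U := by
      intro i
      induction i with
      | zero => simpa using hvU
      | succ i h => rw [pow_succ', Module.End.mul_apply]; exact hU _ h
    have hLU : ∀ a, L a ∈ U := fun a => by
      rw [hL]; exact Submodule.sum_mem _ fun i _ => U.smul_mem _ (hpow i)
    have hΦL : Function.Injective (Φ ∘ₗ L) := by
      rw [← LinearMap.ker_eq_bot, LinearMap.ker_eq_bot']
      intro a ha
      exact hinj a ((hΦ _).1 ha)
    have hsurj : Function.Surjective (Φ ∘ₗ L) := LinearMap.injective_iff_surjective.1 hΦL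
    have hLinj : Function.Injective L := by
      rw [LinearMap.coe_comp] at hΦL
      exact hΦL.of_comp
    set U' := U ⊓ LinearMap.ker Φ with hU'
    have hlt : U' < U := by
      refine lt_of_le_of_ne inf_le_left fun h => ?_
      have hv' : v ∈ U' := h ▸ hvU
      have := (hΦ v).1 hv'.2 (m - 1) (by omega)
      rw [hφ] at this
      exact one_ne_zero this
    obtain ⟨ι, hι, s, w, hs, hw, hli, hspan⟩ := ih U' hlt
      (by
        rintro u ⟨hu, hu'⟩
        refine ⟨hU u hu, (hΦ _).2 fun j hj => ?_⟩
        rw [← Module.End.mul_apply, ← pow_succ]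
        rcases (Nat.succ_le_of_lt hj).eq_or_lt with h | h
        · rw [← Nat.succ_eq_add_one, h, hmU u hu, map_zero]
        · exact (hΦ u).1 hu' _ h)
      ⟨m, fun u hu => hmU u hu.1⟩
    have hli₁ : LinearIndependent K fun i : Fin m => (N ^ (i : ℕ)) v :=
      Fintype.linearIndependent_iff.2 fun a ha =>
        congrFun (hLinj (ha.trans (map_zero L).symm))
    have hspan₁ : Submodule.span K (Set.range fun i : Fin m => (N ^ (i : ℕ)) v) =
        LinearMap.range L := (Fintype.range_linearCombination K _).symm
    let e : (Σ _ : Unit, Fin m) ≃ Fin m := Equiv.uniqueSigma fun _ : Unit => Fin m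
    have hdisj : Disjoint (LinearMap.range L) U' := by
      rw [Submodule.disjoint_def]
      rintro _ ⟨a, rfl⟩ ⟨-, ha⟩
      rw [hinj a ((hΦ _).1 ha), map_zero]
    obtain ⟨h₁, h₂⟩ := linearIndependent_sum_chains (s₁ := fun _ : Unit => m) (s₂ := s)
      (c₁ := fun _ i => (N ^ i) v) (c₂ := fun l i => (N ^ i) (w l))
      (hli₁.comp e e.injective) hli
      ((congrArg _ (e.surjective.range_comp _)).trans hspan₁) hspan hdisj
    have hc : ∀ (l : Unit ⊕ ι) (i : ℕ), Sum.elim (fun (_ : Unit) i => (N ^ i) v)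
        (fun l i => (N ^ i) (w l)) l i = (N ^ i) (Sum.elim (fun _ => v) w l) := by
      rintro (_ | _) _ <;> rfl
    simp only [hc] at h₁ h₂
    refine ⟨Unit ⊕ ι, inferInstance, Sum.elim (fun _ => m) s, Sum.elim (fun _ => v) w, ?_, ?_, h₁,
      h₂.trans (le_antisymm (sup_le ?_ hlt.le) fun u hu => ?_)⟩
    · rintro (_ | l)
      exacts [hm0, hs l]
    · rintro (_ | l)
      exacts [hmU v hvU, hw l]
    · rintro _ ⟨a, rfl⟩
      exact hLU a
    · obtain ⟨a, ha⟩ := hsurj (Φ u)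
      rw [← add_sub_cancel (L a) u]
      refine Submodule.add_mem_sup ⟨a, rfl⟩ ⟨U.sub_mem hu (hLU a), ?_⟩
      change Φ (u - L a) = 0
      rw [map_sub, ← ha, LinearMap.comp_apply, sub_self]

/-! ### Primary decomposition and real irreducible polynomials. -/

theorem disjoint_ker_aeval_and_sup_eq {k K V : Type*} [Field k] [DivisionRing K] [AddCommGroup V]
    [Module K V] [Algebra k (Module.End K V)] (T : Module.End K V) {p q : Polynomial k}
    (h : IsCoprime p q) :
    Disjoint (LinearMap.ker (Polynomial.aeval T p)) (LinearMap.ker (Polynomial.aeval T q)) ∧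
      LinearMap.ker (Polynomial.aeval T p) ⊔ LinearMap.ker (Polynomial.aeval T q) =
        LinearMap.ker (Polynomial.aeval T (p * q)) := by
  obtain ⟨a, b, hab⟩ := h
  have hv : ∀ v, Polynomial.aeval T (a * p) v + Polynomial.aeval T (b * q) v = v := fun v => by
    rw [← LinearMap.add_apply, ← map_add, hab, map_one, Module.End.one_apply]
  have hmul : ∀ (f g : Polynomial k) v, Polynomial.aeval T g v = 0 →
      Polynomial.aeval T (f * g) v = 0 := fun f g v hg => by
    rw [map_mul, Module.End.mul_apply, hg, map_zero]
  refine ⟨?_, le_antisymm (sup_le ?_ ?_) ?_⟩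
  · rw [Submodule.disjoint_def]
    intro v hp hq
    rw [← hv v, hmul _ _ _ hp, hmul _ _ _ hq, add_zero]
  · intro v hp
    rw [mul_comm]
    exact hmul _ _ _ hp
  · exact fun v hq => hmul _ _ _ hq
  · intro v hpq
    rw [← hv v, add_comm]
    have hpq' : Polynomial.aeval T (p * q) v = 0 := hpq
    refine Submodule.add_mem_sup ?_ ?_ <;>
      rw [LinearMap.mem_ker, ← Module.End.mul_apply, ← map_mul]
    · rw [show p * (b * q) = b * (p * q) by ring]
      exact hmul _ _ _ hpq'
    · rw [show q * (a * p) = a * (p * q) by ring]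
      exact hmul _ _ _ hpq'

open Polynomial in
theorem Polynomial.associated_linear_or_quadratic_of_irreducible {p : ℝ[X]} (hp : Irreducible p) :
    (∃ r : ℝ, Associated (X - C r) p) ∨
      ∃ z : ℂ, 0 < z.im ∧ Associated (X ^ 2 - C (2 * z.re) * X + C (‖z‖ ^ 2)) p := by
  obtain ⟨z, hz⟩ := Complex.exists_root (f := p.map (algebraMap ℝ ℂ))
    (by rw [degree_map]; exact degree_pos_of_irreducible hp)
  have h0 : aeval z p = 0 := by rwa [IsRoot.def, eval_map_algebraMap] at hz
  have hquad : ∀ w : ℂ, ¬ IsUnit (X ^ 2 - C (2 * w.re) * X + C (‖w‖ ^ 2) : ℝ[X]) := by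
    intro w h
    have h2 : (X ^ 2 - C (2 * w.re) * X + C (‖w‖ ^ 2) : ℝ[X]).natDegree = 2 := by compute_degree!
    rw [natDegree_eq_zero_of_isUnit h] at h2
    omega
  by_cases him : z.im = 0
  · left
    have hz' : z = algebraMap ℝ ℂ z.re := Complex.ext rfl (by simpa using him)
    rw [hz', aeval_algebraMap_apply, map_eq_zero] at h0
    exact ⟨z.re, ((hp.dvd_iff.1 (dvd_iff_isRoot.2 (by rwa [IsRoot.def, ← coe_aeval_eq_eval]))).resolve_left (not_isUnit_X_sub_C _)).symm⟩
  · right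
    have hd := quadratic_dvd_of_aeval_eq_zero_im_ne_zero p h0 him
    have ha := ((hp.dvd_iff.1 hd).resolve_left (hquad z)).symm
    rcases lt_or_gt_of_ne him with h | h
    -- The quadratic is symmetric in `z` and its conjugate, so the root can be taken in the upper
    -- half-plane, as the Jordan form requires.
    · refine ⟨starRingEnd ℂ z, by simpa using h, by simpa using ha⟩
    · exact ⟨z, h, ha⟩

/-! ### Jordan chains of quaternionic endomorphisms. -/

namespace Quaternion

/-- The quaternion unit `j`. -/
def unitJ : ℍ[ℝ] := ⟨0, 0, 1, 0⟩

@[simp] theorem re_unitJ : unitJ.re = 0 := rfl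

@[simp] theorem imI_unitJ : unitJ.imI = 0 := rfl

@[simp] theorem imJ_unitJ : unitJ.imJ = 1 := rfl

@[simp] theorem imK_unitJ : unitJ.imK = 0 := rfl

theorem unitJ_mul_self : unitJ * unitJ = -1 := by
  ext <;> simp

theorem unitJ_mul_coeComplex (z : ℂ) : unitJ * (z : ℍ[ℝ]) = (starRingEnd ℂ z : ℂ) * unitJ := by
  ext <;> simp

end Quaternion

section Chains

variable {V : Type*} [AddCommGroup V] [Module ℍ[ℝ] V]

/-- The additive map `w ↦ T w - z w`, for a complex number `z` acting through the quaternions. -/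
noncomputable def eigenShift (T : Module.End ℍ[ℝ] V) (z : ℂ) (w : V) : V := T w - (z : ℍ[ℝ]) • w

/-- The subspace `U` has a basis consisting of Jordan chains of `T`, each generated by a vector
`v l` with respect to a complex number `lam l` with non-negative imaginary part. -/
def HasJordanChains (T : Module.End ℍ[ℝ] V) (U : Submodule ℍ[ℝ] V) : Prop :=
  ∃ (ι : Type) (_ : Fintype ι) (lam : ι → ℂ) (s : ι → ℕ) (v : ι → V),
    (∀ l, 0 ≤ (lam l).im) ∧ (∀ l, 0 < s l) ∧ (∀ l, (eigenShift T (lam l))^[s l] (v l) = 0) ∧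
    LinearIndependent ℍ[ℝ] (fun p : Σ l, Fin (s l) => (eigenShift T (lam p.1))^[p.2] (v p.1)) ∧
    Submodule.span ℍ[ℝ]
      (Set.range fun p : Σ l, Fin (s l) => (eigenShift T (lam p.1))^[p.2] (v p.1)) = U

theorem hasJordanChains_bot (T : Module.End ℍ[ℝ] V) : HasJordanChains T ⊥ := by
  refine ⟨Empty, inferInstance, fun _ => 0, fun _ => 0, fun _ => 0, by simp, by simp, by simp,
    linearIndependent_empty_type, ?_⟩
  rw [Set.range_eq_empty, Submodule.span_empty]

theorem HasJordanChains.sup {T : Module.End ℍ[ℝ] V} {U₁ U₂ : Submodule ℍ[ℝ] V}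
    (h₁ : HasJordanChains T U₁) (h₂ : HasJordanChains T U₂) (hd : Disjoint U₁ U₂) :
    HasJordanChains T (U₁ ⊔ U₂) := by
  obtain ⟨ι₁, _, lam₁, s₁, v₁, him₁, hs₁, hv₁, hli₁, hspan₁⟩ := h₁
  obtain ⟨ι₂, _, lam₂, s₂, v₂, him₂, hs₂, hv₂, hli₂, hspan₂⟩ := h₂
  obtain ⟨h₁, h₂⟩ := linearIndependent_sum_chains
    (c₁ := fun l i => (eigenShift T (lam₁ l))^[i] (v₁ l))
    (c₂ := fun l i => (eigenShift T (lam₂ l))^[i] (v₂ l)) hli₁ hli₂ hspan₁ hspan₂ hd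
  have hc : ∀ (l : ι₁ ⊕ ι₂) (i : ℕ),
      Sum.elim (fun l i => (eigenShift T (lam₁ l))^[i] (v₁ l))
        (fun l i => (eigenShift T (lam₂ l))^[i] (v₂ l)) l i =
      (eigenShift T (Sum.elim lam₁ lam₂ l))^[i] (Sum.elim v₁ v₂ l) := by
    rintro (_ | _) _ <;> rfl
  simp only [hc] at h₁ h₂
  refine ⟨ι₁ ⊕ ι₂, inferInstance, Sum.elim lam₁ lam₂, Sum.elim s₁ s₂, Sum.elim v₁ v₂,
    ?_, ?_, ?_, h₁, h₂⟩ <;> rintro (l | l)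
  exacts [him₁ l, him₂ l, hs₁ l, hs₂ l, hv₁ l, hv₂ l]

/-- Multiplication by `j` exchanges the chains of `z` with those of its conjugate, so one of the two
families suffices over `ℍ`. -/
theorem eigenShift_conj_smul (T : Module.End ℍ[ℝ] V) (z : ℂ) (v : V) :
    eigenShift T (starRingEnd ℂ z) (Quaternion.unitJ • v) =
      Quaternion.unitJ • eigenShift T z v := by
  simp only [eigenShift, map_smul, smul_sub, smul_smul, Quaternion.unitJ_mul_coeComplex]

variable [Module ℝ V] [IsScalarTower ℝ ℍ[ℝ] V]

theorem coeComplex_ofReal_smul (r : ℝ) (w : V) : (((r : ℂ) : ℍ[ℝ])) • w = r • w := by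
  rw [Quaternion.coeComplex_coe, ← algebraMap_smul ℍ[ℝ] r w]
  rfl

open Polynomial in
theorem hasJordanChains_ker_linear_pow [FiniteDimensional ℍ[ℝ] V] (T : Module.End ℍ[ℝ] V) (r : ℝ)
    (k : ℕ) : HasJordanChains T (LinearMap.ker (aeval T ((X - C r) ^ k))) := by
  set N := aeval T (X - C r) with hN
  have hNs : ⇑N = eigenShift T r := by
    funext w
    rw [hN, eigenShift, coeComplex_ofReal_smul]
    simp
  obtain ⟨ι, hι, s, v, hs, hv, hli, hspan⟩ := exists_nilpotent_chains N
    (LinearMap.ker (N ^ k)) (fun u hu => by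
      rw [LinearMap.mem_ker] at hu ⊢
      rw [← Module.End.mul_apply, ← pow_succ, pow_succ', Module.End.mul_apply, hu, map_zero])
    ⟨k, fun u hu => hu⟩
  simp only [Module.End.coe_pow, hNs] at hv hli hspan
  refine ⟨ι, hι, fun _ => r, s, v, by simp, hs, hv, hli, ?_⟩
  rw [hspan, map_pow]

open Polynomial in
theorem aeval_quadratic_apply (T : Module.End ℍ[ℝ] V) (z : ℂ) (v : V) :
    aeval T (X ^ 2 - C (2 * z.re) * X + C (‖z‖ ^ 2)) v =
      eigenShift T z (eigenShift T (starRingEnd ℂ z) v) := by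
  have h₁ : (2 * z.re) • T v = ((z + starRingEnd ℂ z : ℂ) : ℍ[ℝ]) • T v := by
    rw [Complex.add_conj, coeComplex_ofReal_smul]
  have h₂ : (‖z‖ ^ 2) • v = ((z * starRingEnd ℂ z : ℂ) : ℍ[ℝ]) • v := by
    rw [Complex.mul_conj', ← Complex.ofReal_pow, coeComplex_ofReal_smul]
  have h₃ : aeval T (X ^ 2 - C (2 * z.re) * X + C (‖z‖ ^ 2)) =
      T * T - (2 * z.re) • T + (‖z‖ ^ 2) • (1 : Module.End ℍ[ℝ] V) := by
    rw [map_add, map_sub, map_mul, aeval_C, aeval_C, map_pow, aeval_X, pow_two T,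
      Algebra.smul_def, Algebra.smul_def, mul_one]
  rw [h₃]
  simp only [LinearMap.add_apply, LinearMap.sub_apply, LinearMap.smul_apply, Module.End.mul_apply,
    Module.End.one_apply]
  rw [h₁, h₂, Quaternion.coeComplex_add, Quaternion.coeComplex_mul, add_smul, mul_smul]
  simp only [eigenShift, map_sub, map_smul, smul_sub]
  abel

open Polynomial in
-- A non-real `z` is not central, so `T - z` is only `ℂ`-linear. Over `ℂ` the kernel splits into
-- generalized eigenspaces `W` and `W'` of `z` and its conjugate, exchanged by `j`. Since `ℍ = ℂ +
-- jℂ`, a `ℂ`-basis of `W` made of chains is an `ℍ`-basis of the whole kernel.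
theorem hasJordanChains_ker_quadratic_pow [FiniteDimensional ℍ[ℝ] V] (T : Module.End ℍ[ℝ] V)
    {z : ℂ} (hz : 0 < z.im) (k : ℕ) :
    HasJordanChains T
      (LinearMap.ker (aeval T ((X ^ 2 - C (2 * z.re) * X + C (‖z‖ ^ 2)) ^ k))) := by
  classical
  let : Module ℂ V := Module.compHom V Quaternion.ofComplex.toRingHom
  have hc : ∀ (a : ℂ) (v : V), a • v = (a : ℍ[ℝ]) • v := fun a v => rfl
  have : IsScalarTower ℝ ℂ V := ⟨fun r a v => by
    change ((r • a : ℂ) : ℍ[ℝ]) • v = r • (a : ℍ[ℝ]) • v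
    rw [Complex.real_smul, Quaternion.coeComplex_mul, mul_smul, coeComplex_ofReal_smul]⟩
  have : Module.Finite ℝ V := Module.Finite.trans ℍ[ℝ] V
  have : FiniteDimensional ℂ V := Module.Finite.of_restrictScalars_finite ℝ ℂ V
  let Tc : Module.End ℂ V :=
    { toFun := T, map_add' := map_add T, map_smul' := fun a v => map_smul T (a : ℍ[ℝ]) v }
  have hshift : ∀ w : ℂ, ⇑(aeval Tc (X - C w)) = eigenShift T w := by
    intro w
    funext v
    rw [eigenShift, ← hc]
    simp only [map_sub, aeval_X, aeval_C, LinearMap.sub_apply, Module.algebraMap_end_apply]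
    rfl
  have hpow : ∀ (w : ℂ) v, aeval Tc ((X - C w) ^ k) v = (eigenShift T w)^[k] v := by
    intro w v
    rw [map_pow, Module.End.coe_pow, hshift]
  have hq : ∀ v, aeval T ((X ^ 2 - C (2 * z.re) * X + C (‖z‖ ^ 2)) ^ k) v =
      aeval Tc ((X - C z) ^ k * (X - C (starRingEnd ℂ z)) ^ k) v := by
    intro v
    rw [← mul_pow, map_pow (aeval T), map_pow (aeval Tc), Module.End.coe_pow, Module.End.coe_pow]
    congr 1
    funext w
    rw [aeval_quadratic_apply, map_mul, Module.End.mul_apply, hshift, hshift]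
  have hne : z ≠ starRingEnd ℂ z := fun h => by
    have := congrArg Complex.im h
    rw [Complex.conj_im] at this
    linarith
  obtain ⟨hdisj, hsup⟩ := disjoint_ker_aeval_and_sup_eq Tc
    (p := (X - C z) ^ k) (q := (X - C (starRingEnd ℂ z)) ^ k)
    ((isCoprime_X_sub_C_of_isUnit_sub (sub_ne_zero.2 hne).isUnit).pow)
  set W := LinearMap.ker (aeval Tc ((X - C z) ^ k)) with hW
  set W' := LinearMap.ker (aeval Tc ((X - C (starRingEnd ℂ z)) ^ k)) with hW'
  set J := Quaternion.unitJ with hJ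
  have hJJ : J * J = -1 := Quaternion.unitJ_mul_self
  have hsemi : ∀ (w : ℂ) v, (eigenShift T (starRingEnd ℂ w))^[k] (J • v) =
      J • (eigenShift T w)^[k] v := fun w v =>
    ((Function.Semiconj.iterate_right (f := fun v => J • v)
      (fun v => (eigenShift_conj_smul T w v).symm) k) v).symm
  have hJW : ∀ v ∈ W, J • v ∈ W' := fun v hv => by
    rw [hW, LinearMap.mem_ker, hpow] at hv
    rw [hW', LinearMap.mem_ker, hpow, hsemi, hv, smul_zero]
  have hJW' : ∀ v ∈ W', J • v ∈ W := fun v hv => by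
    rw [hW', LinearMap.mem_ker, hpow] at hv
    have := hsemi (starRingEnd ℂ z) v
    rw [hv, smul_zero, Complex.conj_conj] at this
    rwa [hW, LinearMap.mem_ker, hpow]
  obtain ⟨ι, hι, s, v, hs, hv, hli, hspan⟩ := exists_nilpotent_chains (aeval Tc (X - C z)) W
    (fun u hu => by
      rw [hW, map_pow, LinearMap.mem_ker] at hu ⊢
      rw [← Module.End.mul_apply, ← pow_succ, pow_succ', Module.End.mul_apply, hu, map_zero])
    ⟨k, fun u hu => by rwa [hW, map_pow] at hu⟩
  simp only [Module.End.coe_pow, hshift] at hv hli hspan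
  set f := fun p : Σ l, Fin (s l) => (eigenShift T z)^[p.2] (v p.1) with hf
  have hfW : ∀ p, f p ∈ W := fun p => hspan ▸ Submodule.subset_span ⟨p, rfl⟩
  refine ⟨ι, hι, fun _ => z, s, v, fun _ => hz.le, hs, hv, ?_, le_antisymm ?_ ?_⟩
  · change LinearIndependent ℍ[ℝ] f
    rw [Fintype.linearIndependent_iff] at hli ⊢
    intro g hg
    -- Write `g = a + j b`; the sign in `b` comes from `j i = -k`. The two parts of the relation lie
    -- in `W` and `W'`, hence vanish separately.
    let a : (Σ l, Fin (s l)) → ℂ := fun p => ⟨(g p).re, (g p).imI⟩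
    let b : (Σ l, Fin (s l)) → ℂ := fun p => ⟨(g p).imJ, -(g p).imK⟩
    have hgab : ∀ p, g p = a p + J * b p := fun p => by
      ext <;> simp [a, b, hJ]
    have hsum : ∑ p, a p • f p + J • ∑ p, b p • f p = 0 := by
      rw [← hg, Finset.smul_sum, ← Finset.sum_add_distrib]
      refine Finset.sum_congr rfl fun p _ => ?_
      rw [hgab p, add_smul, mul_smul, hc, hc]
    have hA : ∑ p, a p • f p ∈ W := Submodule.sum_mem _ fun p _ => W.smul_mem _ (hfW p)
    have hB : ∑ p, b p • f p ∈ W := Submodule.sum_mem _ fun p _ => W.smul_mem _ (hfW p)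
    have hA0 : ∑ p, a p • f p = 0 := by
      refine (Submodule.disjoint_def.1 hdisj) _ hA ?_
      rw [eq_neg_of_add_eq_zero_left hsum]
      exact W'.neg_mem (hJW _ hB)
    have hB0 : ∑ p, b p • f p = 0 := by
      rw [hA0, zero_add] at hsum
      have := congrArg (fun w => J • w) hsum
      simpa [smul_smul, hJJ] using this
    intro p
    rw [hgab, hli a hA0 p, hli b hB0 p]
    simp
  · rw [Submodule.span_le]
    rintro _ ⟨p, rfl⟩
    change aeval T _ (f p) = 0
    rw [hq, ← LinearMap.mem_ker, ← hsup]
    exact Submodule.mem_sup_left (hfW p)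
  · intro u hu
    rw [LinearMap.mem_ker, hq, ← LinearMap.mem_ker, ← hsup, Submodule.mem_sup] at hu
    obtain ⟨w, hw, w', hw', rfl⟩ := hu
    have hle : ∀ w ∈ W, w ∈ Submodule.span ℍ[ℝ] (Set.range f) := by
      intro w hw
      rw [← hspan] at hw
      induction hw using Submodule.span_induction with
      | mem x hx => exact Submodule.subset_span hx
      | zero => exact Submodule.zero_mem _
      | add x y _ _ hx hy => exact Submodule.add_mem _ hx hy
      | smul a x _ hx => exact Submodule.smul_mem _ (a : ℍ[ℝ]) hx
    refine Submodule.add_mem _ (hle w hw) ?_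
    have : w' = (-J) • (J • w') := by rw [smul_smul, neg_mul, hJJ, neg_neg, one_smul]
    rw [this]
    exact Submodule.smul_mem _ _ (hle _ (hJW' w' hw'))

open Polynomial in
theorem hasJordanChains_ker_aeval [FiniteDimensional ℍ[ℝ] V] (T : Module.End ℍ[ℝ] V) (p : ℝ[X])
    (hp : p ≠ 0) : HasJordanChains T (LinearMap.ker (aeval T p)) := by
  have hassoc : ∀ {p q : ℝ[X]}, p ∣ q →
      LinearMap.ker (aeval T p) ≤ LinearMap.ker (aeval T q) := by
    rintro p _ ⟨c, rfl⟩ v hv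
    rw [LinearMap.mem_ker] at hv ⊢
    rw [mul_comm, map_mul, Module.End.mul_apply, hv, map_zero]
  have hassoc' : ∀ {p q : ℝ[X]}, Associated p q →
      LinearMap.ker (aeval T p) = LinearMap.ker (aeval T q) := fun h =>
    le_antisymm (hassoc h.dvd) (hassoc h.symm.dvd)
  induction p using UniqueFactorizationMonoid.induction_on_coprime with
  | h0 => exact absurd rfl hp
  | @h1 x hx =>
    rw [← hassoc' (associated_one_iff_isUnit.2 hx).symm, map_one]
    convert hasJordanChains_bot T
    exact LinearMap.ker_id
  | @hpr x i hx =>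
    rcases Polynomial.associated_linear_or_quadratic_of_irreducible hx.irreducible with
      ⟨r, h⟩ | ⟨z, hz, h⟩
    · rw [← hassoc' (h.pow_pow (n := i))]
      exact hasJordanChains_ker_linear_pow T r i
    · rw [← hassoc' (h.pow_pow (n := i))]
      exact hasJordanChains_ker_quadratic_pow T hz i
  | @hcp x y hxy ihx ihy =>
    obtain ⟨hd, hs⟩ := disjoint_ker_aeval_and_sup_eq T hxy.isCoprime
    rw [← hs]
    exact (ihx (left_ne_zero_of_mul hp)).sup (ihy (right_ne_zero_of_mul hp)) hd

theorem hasJordanChains_top [FiniteDimensional ℍ[ℝ] V] (T : Module.End ℍ[ℝ] V) :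
    HasJordanChains T ⊤ := by
  have : Module.Finite ℝ V := Module.Finite.trans ℍ[ℝ] V
  -- Real scalars are central, so `T` has a minimal polynomial over `ℝ` once the endomorphism ring
  -- is finite over `ℝ`.
  have : Module.Finite ℝ (Module.End ℍ[ℝ] V) :=
    Module.Finite.of_injective (LinearMap.restrictScalarsₗ ℝ ℍ[ℝ] V V ℝ)
      (LinearMap.restrictScalars_injective ℝ)
  have h := hasJordanChains_ker_aeval T (minpoly ℝ T)
    (minpoly.ne_zero (Algebra.IsIntegral.isIntegral T))
  rwa [minpoly.aeval, LinearMap.ker_zero] at h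

end Chains

/-! ### Existence of the Jordan form of a matrix. -/

theorem sum_jordanBlock_smul {V : Type*} [AddCommGroup V] [Module ℍ[ℝ] V] (a : ℍ[ℝ]) {m : ℕ}
    (g : ℕ → V) (hg : g m = 0) (i : Fin m) :
    ∑ j, jordanBlock a m i j • g j = a • g i + g (i + 1) := by
  have hsplit : ∀ j : Fin m, jordanBlock a m i j • g j =
      (if i = j then a • g j else 0) + (if (i : ℕ) + 1 = j then g j else 0) := by
    intro j
    rw [jordanBlock, Matrix.of_apply]
    split_ifs with h₁ h₂
    · subst h₁; omega
    · simp
    · simp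
    · simp
  rw [Finset.sum_congr rfl fun j _ => hsplit j, Finset.sum_add_distrib, Finset.sum_ite_eq]
  simp only [Finset.mem_univ, if_true]
  congr 1
  by_cases h : (i : ℕ) + 1 < m
  · rw [Finset.sum_eq_single ⟨i + 1, h⟩]
    · simp
    · intro j _ hj
      exact if_neg fun h' => hj (Fin.ext h'.symm)
    · simp
  · rw [show (i : ℕ) + 1 = m by omega, hg]
    exact Finset.sum_eq_zero fun j _ => if_neg j.2.ne'

/-- The direct sum of the Jordan blocks `J(lam l, s l)`. -/
noncomputable def jordanMatrix {ι : Type*} [DecidableEq ι] (lam : ι → ℂ) (s : ι → ℕ) :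
    Matrix (Σ l, Fin (s l)) (Σ l, Fin (s l)) ℍ[ℝ] :=
  Matrix.blockDiagonal' fun l => jordanBlock (lam l : ℍ[ℝ]) (s l)

theorem sum_jordanMatrix_smul {V ι : Type*} [AddCommGroup V] [Module ℍ[ℝ] V] [Fintype ι]
    [DecidableEq ι] {lam : ι → ℂ} {s : ι → ℕ} (g : ι → ℕ → V) (hg : ∀ l, g l (s l) = 0)
    (p : Σ l, Fin (s l)) :
    ∑ q, jordanMatrix lam s p q • g q.1 q.2 =
      (lam p.1 : ℍ[ℝ]) • g p.1 p.2 + g p.1 (p.2 + 1) := by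
  obtain ⟨l, i⟩ := p
  rw [Fintype.sum_sigma, Finset.sum_eq_single l]
  · simp only [jordanMatrix, Matrix.blockDiagonal'_apply_eq]
    exact sum_jordanBlock_smul _ (g l) (hg l) i
  · intro l' _ hl'
    refine Finset.sum_eq_zero fun j _ => ?_
    rw [jordanMatrix, Matrix.blockDiagonal'_apply_ne _ _ _ hl'.symm, zero_smul]
  · simp

theorem jordanMatrix_apply {ι : Type*} [DecidableEq ι] (lam : ι → ℂ) (s : ι → ℕ)
    (p q : Σ l, Fin (s l)) :
    jordanMatrix lam s p q = if p = q then (lam p.1 : ℍ[ℝ]) else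
      if p.1 = q.1 ∧ (p.2 : ℕ) + 1 = q.2 then 1 else 0 := by
  obtain ⟨l, i⟩ := p
  obtain ⟨l', j⟩ := q
  by_cases h : l = l'
  · subst h
    simp [jordanMatrix, Matrix.blockDiagonal'_apply_eq, jordanBlock]
  · simp [jordanMatrix, Matrix.blockDiagonal'_apply_ne _ _ _ h, h]

/-- Right multiplication of row vectors by a matrix. -/
def rowEnd {R : Type*} [Semiring R] {n : ℕ} (A : Matrix (Fin n) (Fin n) R) :
    Module.End R (Fin n → R) where
  toFun v := Matrix.vecMul v A
  map_add' v w := Matrix.add_vecMul A v w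
  map_smul' c v := Matrix.smul_vecMul c v A

/-- Right multiplication on row vectors is linear for left scalars. With the chain vectors as rows
of `S`, the relation `T gᵢ = λ gᵢ + gᵢ₊₁` is a row of `S A = J S`. -/
theorem nonempty_jordanDecomposition {n : ℕ} (A : GlH n) : Nonempty (JordanDecomposition A) := by
  classical
  obtain ⟨ι, _, lam', s', v', him, hs, hv, hli, hspan⟩ := hasJordanChains_top (rowEnd A)
  let e := (Fintype.equivFin ι).symm
  let lam := lam' ∘ e
  let s := s' ∘ e
  let g : Fin (Fintype.card ι) → ℕ → (Fin n → ℍ[ℝ]) := fun l i =>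
    (eigenShift (rowEnd A) (lam l))^[i] (v' (e l))
  let E : (Σ l, Fin (s l)) ≃ Σ l, Fin (s' l) := Equiv.sigmaCongrLeft (β := fun l => Fin (s' l)) e
  have hE : (fun p : Σ l, Fin (s l) => g p.1 p.2) =
      (fun p : Σ l, Fin (s' l) => (eigenShift (rowEnd A) (lam' p.1))^[p.2] (v' p.1)) ∘ E := rfl
  let b := Module.Basis.mk (v := fun p : Σ l, Fin (s l) => g p.1 p.2)
    (by rw [hE]; exact hli.comp E E.injective)
    (by rw [hE, E.surjective.range_comp, hspan])
  have hb : ∀ p, b p = g p.1 p.2 := fun p => Module.Basis.mk_apply _ _ p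
  let rows : (Σ l, Fin (s l)) ≃ Fin n := b.indexEquiv (Pi.basisFun ℍ[ℝ] (Fin n))
  let S : GlH n := Matrix.of fun r => b (rows.symm r)
  let C : GlH n := Matrix.of fun i r => b.repr (Pi.single i 1) (rows.symm r)
  have hCS : C * S = 1 := by
    ext i j : 1
    have h := congrFun (b.sum_repr (Pi.single i 1)) j
    rw [Finset.sum_apply] at h
    rw [Matrix.mul_apply, Matrix.one_eq_pi_single, ← h, ← rows.symm.sum_comp]
    rfl
  have hSC : S * C = 1 := mul_eq_one_comm.1 hCS
  have hSA : S * A = Matrix.reindex rows rows (jordanMatrix lam s) * S := by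
    ext r j : 1
    have h₁ := sum_jordanMatrix_smul (lam := lam) (s := s) g (fun l => hv (e l)) (rows.symm r)
    have h₂ : (lam (rows.symm r).1 : ℍ[ℝ]) • g (rows.symm r).1 (rows.symm r).2 +
        g (rows.symm r).1 ((rows.symm r).2 + 1) = rowEnd A (b (rows.symm r)) := by
      rw [hb]
      simp only [g, Function.iterate_succ_apply']
      rw [eigenShift, add_sub_cancel]
    have h := congrFun (h₁.trans h₂) j
    rw [Finset.sum_apply] at h
    refine Eq.trans h.symm ?_
    rw [Matrix.mul_apply, ← rows.symm.sum_comp]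
    refine Finset.sum_congr rfl fun q _ => ?_
    rw [← hb]
    rfl
  refine ⟨⟨_, lam, s, fun l => hs (e l), fun l => him (e l), rows, ⟨S, C, hSC, hCS⟩, ?_⟩⟩
  change S * A * C = Matrix.reindex rows rows (jordanMatrix lam s)
  rw [hSA, mul_assoc, hSC, mul_one]

/-! ### Matrices anticommuting with a Jordan matrix. -/

theorem Quaternion.re_eq_re_of_mul_eq_mul {x a c : ℍ[ℝ]} (hx : x ≠ 0) (h : x * a = c * x) :
    a.re = c.re := by
  have h₁ : (x * a * star x).re = normSq x * a.re := by
    rw [normSq_def']; simp; ring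
  have h₂ : (c * x * star x).re = normSq x * c.re := by
    rw [mul_assoc, self_mul_star]; simp; ring
  rw [h, h₂] at h₁
  exact (mul_left_cancel₀ (normSq_ne_zero.2 hx) h₁).symm

theorem jordanMatrix_anticommute_apply_eq_zero {ι : Type*} [Fintype ι] [DecidableEq ι]
    {lam : ι → ℂ} {s : ι → ℕ} {G : Matrix (Σ l, Fin (s l)) (Σ l, Fin (s l)) ℍ[ℝ]}
    (hG : G * jordanMatrix lam s = -(jordanMatrix lam s * G)) {p q : Σ l, Fin (s l)}
    (hpq : (lam p.1).re ≠ -(lam q.1).re) : G p q = 0 := by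
  -- This measures the distance to the bottom left corner of the block of `G`. Entry `(p, q)` of the
  -- relation involves `G p q` and its neighbours below and to the left, which vanish by induction.
  -- What remains is `G p q * λ_q = -λ_p * G p q`, and conjugate quaternions have equal real parts.
  induction hm : s p.1 - p.2 + q.2 using Nat.strong_induction_on generalizing p q with
  | _ m ih =>
    subst hm
    have h := congrFun (congrFun hG p) q
    rw [Matrix.neg_apply, Matrix.mul_apply, Matrix.mul_apply, Finset.sum_eq_single q,
      Finset.sum_eq_single p] at h
    · rw [jordanMatrix_apply, jordanMatrix_apply, if_pos rfl, if_pos rfl, ← neg_mul] at h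
      by_contra hx
      have := Quaternion.re_eq_re_of_mul_eq_mul hx h
      rw [Quaternion.re_neg, Quaternion.re_coeComplex, Quaternion.re_coeComplex] at this
      exact hpq (by rw [this, neg_neg])
    · intro r _ hr
      rw [jordanMatrix_apply, if_neg hr.symm]
      split_ifs with h'
      · obtain ⟨h₁, h₂⟩ := h'
        obtain ⟨l, i⟩ := p
        obtain ⟨l', j⟩ := r
        dsimp only at h₁ h₂ hpq ih
        subst h₁
        rw [ih _ _ hpq rfl, mul_zero]
        dsimp only
        omega
      · rw [zero_mul]
    · simp
    · intro r _ hr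
      rw [jordanMatrix_apply, if_neg hr]
      split_ifs with h'
      · obtain ⟨h₁, h₂⟩ := h'
        rw [ih _ _ (by rwa [h₁]) rfl, zero_mul]
        omega
      · rw [mul_zero]
    · simp

/-! ### The explicit involution for imaginary eigenvalues. -/

theorem exists_pairing_of_even_card {α : Type*} [Finite α] (h : Even (Nat.card α)) :
    ∃ (π : α → α) (ε : α → ℝ), (∀ a, π (π a) = a) ∧ (∀ a, ε a * ε a = 1) ∧
      ∀ a, ε (π a) = -ε a := by
  obtain ⟨m, hm⟩ := h
  have e : α ≃ Fin m × Bool := (Finite.card_eq.1 (by simp [hm, mul_two])).some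
  refine ⟨fun a => e.symm ((e a).1, !(e a).2), fun a => if (e a).2 then 1 else -1, ?_, ?_, ?_⟩
  · intro a; simp
  · intro a; dsimp only; split_ifs <;> norm_num
  · intro a; cases h : (e a).2 <;> simp [h]

theorem exists_pairing_of_even_fibers {α β : Type*} [Finite α] (f : α → β)
    (h : ∀ b, Even (Nat.card {a // f a = b})) :
    ∃ (π : α → α) (ε : α → ℝ), (∀ a, π (π a) = a) ∧ (∀ a, ε a * ε a = 1) ∧
      (∀ a, ε (π a) = -ε a) ∧ ∀ a, f (π a) = f a := by
  choose π ε h₁ h₂ h₃ using fun b => exists_pairing_of_even_card (h b)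
  let e := Equiv.sigmaFiberEquiv f
  let F : (Σ b, {a // f a = b}) → Σ b, {a // f a = b} := fun x => ⟨x.1, π x.1 x.2⟩
  let E : (Σ b, {a // f a = b}) → ℝ := fun x => ε x.1 x.2
  have hF : ∀ x, F (F x) = x := fun x => by simp only [F, h₁]
  have hE : ∀ x, E (F x) = -E x := fun x => h₃ _ _
  refine ⟨fun a => e (F (e.symm a)), fun a => E (e.symm a), fun a => ?_, fun a => h₂ _ _,
    fun a => ?_, fun a => (π _ (e.symm a).2).2.trans (e.symm a).2.2.symm⟩
  · simp only [Equiv.symm_apply_apply, hF, Equiv.apply_symm_apply]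
  · simp only [Equiv.symm_apply_apply, hE]

/-- A quaternion `c` anticommuting with `μ ≠ 0` imaginary lies in `jℂ`, where squares are
non-positive real numbers, so a block cannot be treated alone. On a pair, `c = ε j` with opposite
signs `ε` gives product `1`. Blocks with eigenvalue `0` get weight `1`, those off the imaginary axis
weight `0`. -/
theorem jordanMatrix_exists_weights {ι : Type*} [Finite ι] (lam : ι → ℂ) (s : ι → ℕ)
    (h : ∀ μ m, μ ≠ 0 → μ.re = 0 → Even (Nat.card {l : ι // lam l = μ ∧ s l = m})) :
    ∃ (π : ι → ι) (c : ι → ℍ[ℝ]), (∀ l, π (π l) = l) ∧ (∀ l, lam (π l) = lam l) ∧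
      (∀ l, s (π l) = s l) ∧ (∀ l, c l * lam l = -(lam l * c l)) ∧
      ∀ l, c l * c (π l) = if (lam l).re = 0 then 1 else 0 := by
  classical
  let Z := {l : ι // lam l ≠ 0 ∧ (lam l).re = 0}
  obtain ⟨π, ε, h₁, h₂, h₃, h₄⟩ := exists_pairing_of_even_fibers
    (fun l : Z => (lam l, s l)) (by
      rintro ⟨μ, m⟩
      by_cases hμ : μ ≠ 0 ∧ μ.re = 0
      · convert h μ m hμ.1 hμ.2 using 1
        refine Nat.card_congr ⟨fun l => ⟨l.1.1, Prod.ext_iff.1 l.2⟩,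
          fun l => ⟨⟨l.1, by rw [l.2.1]; exact hμ⟩, Prod.ext_iff.2 l.2⟩, fun _ => rfl, fun _ => rfl⟩
      · have : IsEmpty {l : Z // (lam l, s l) = (μ, m)} :=
          ⟨fun l => hμ ((show lam l.1 = μ from (Prod.ext_iff.1 l.2).1) ▸ l.1.2)⟩
        rw [Nat.card_of_isEmpty]
        exact Even.zero)
  refine ⟨fun l => if hl : lam l ≠ 0 ∧ (lam l).re = 0 then π ⟨l, hl⟩ else l,
    fun l => if hl : lam l ≠ 0 ∧ (lam l).re = 0 then (ε ⟨l, hl⟩ : ℍ[ℝ]) * Quaternion.unitJ else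
      if (lam l).re = 0 then 1 else 0, ?_, ?_, ?_, ?_, ?_⟩ <;> intro l <;>
    by_cases hl : lam l ≠ 0 ∧ (lam l).re = 0
  · have := (π ⟨l, hl⟩).2
    simp [dif_pos hl, dif_pos this, h₁]
  · simp only [dif_neg hl]
  · simp only [dif_pos hl]
    exact (Prod.ext_iff.1 (h₄ ⟨l, hl⟩)).1
  · simp only [dif_neg hl]
  · simp only [dif_pos hl]
    exact (Prod.ext_iff.1 (h₄ ⟨l, hl⟩)).2
  · simp only [dif_neg hl]
  · simp only [dif_pos hl]
    have hc : starRingEnd ℂ (lam l) = -lam l := Complex.ext (by simp [hl.2]) (by simp)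
    have hc' : ((-lam l : ℂ) : ℍ[ℝ]) = -(lam l : ℍ[ℝ]) := by ext <;> simp
    rw [mul_assoc, Quaternion.unitJ_mul_coeComplex, hc, hc', neg_mul, mul_neg, ← mul_assoc,
      ← mul_assoc, Quaternion.coe_commutes]
  · simp only [dif_neg hl]
    split_ifs with h0
    · have : lam l = 0 := by_contra fun h' => hl ⟨h', h0⟩
      simp [this]
    · simp
  · have := (π ⟨l, hl⟩).2
    simp only [dif_pos hl, dif_pos this, if_pos hl.2, Subtype.coe_eta, h₃]
    rw [Quaternion.coe_neg, mul_assoc, ← mul_assoc Quaternion.unitJ, mul_neg,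
      ← Quaternion.coe_commutes, neg_mul, mul_assoc, Quaternion.unitJ_mul_self, mul_neg_one,
      neg_neg, ← Quaternion.coe_mul, h₂, Quaternion.coe_one]
  · simp only [dif_neg hl]
    split_ifs <;> simp

/-- Even multiplicities give a matrix anticommuting with the Jordan matrix whose square is the
projection to the blocks with purely imaginary eigenvalue. -/
theorem jordanMatrix_exists_partial_involution {ι : Type*} [Fintype ι] [DecidableEq ι]
    (lam : ι → ℂ) (s : ι → ℕ)
    (h : ∀ μ m, μ ≠ 0 → μ.re = 0 → Even (Nat.card {l : ι // lam l = μ ∧ s l = m})) :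
    ∃ τ : Matrix (Σ l, Fin (s l)) (Σ l, Fin (s l)) ℍ[ℝ],
      τ * jordanMatrix lam s = -(jordanMatrix lam s * τ) ∧
      τ * τ = Matrix.diagonal fun p => if (lam p.1).re = 0 then 1 else 0 := by
  obtain ⟨π, c, hπ, hlam, hs, hc, hcc⟩ := jordanMatrix_exists_weights lam s h
  let σ : (Σ l, Fin (s l)) → Σ l, Fin (s l) := fun p => ⟨π p.1, Fin.cast (hs p.1).symm p.2⟩
  have hext : ∀ p q : Σ l, Fin (s l), p.1 = q.1 → (p.2 : ℕ) = q.2 → p = q := by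
    rintro ⟨l, i⟩ ⟨l', j⟩ h₁ h₂
    dsimp only at h₁
    subst h₁
    exact congrArg _ (Fin.ext h₂)
  have hσ : ∀ p, σ (σ p) = p := fun p => hext _ _ (hπ p.1) rfl
  have hB : ∀ p q, jordanMatrix lam s (σ p) (σ q) = jordanMatrix lam s p q := by
    intro p q
    have hinj : σ p = σ q ↔ p = q := (Function.LeftInverse.injective hσ).eq_iff
    have hinj' : π p.1 = π q.1 ↔ p.1 = q.1 := (Function.LeftInverse.injective hπ).eq_iff
    rw [jordanMatrix_apply, jordanMatrix_apply]
    simp only [hinj]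
    simp only [σ, hlam, Fin.val_cast, hinj']
  -- The factor `c` reverses the diagonal of the Jordan matrix, the alternating sign its
  -- super-diagonal.
  let d : (Σ l, Fin (s l)) → ℍ[ℝ] := fun p => (-1) ^ (p.2 : ℕ) * c p.1
  have hd : ∀ p r, d p * jordanMatrix lam s p r = -(jordanMatrix lam s p r * d r) := by
    intro p r
    rw [jordanMatrix_apply]
    split_ifs with h₁ h₂
    · subst h₁
      rw [mul_assoc, hc, mul_neg, ← mul_assoc, ← mul_assoc,
        ((Commute.neg_one_left _).pow_left _).eq]
    · simp only [d, ← h₂.1, ← h₂.2, pow_succ]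
      simp
    · simp
  let τ : Matrix (Σ l, Fin (s l)) (Σ l, Fin (s l)) ℍ[ℝ] :=
    Matrix.of fun p q => if σ p = q then d p else 0
  refine ⟨τ, ?_, ?_⟩
  · refine Matrix.ext fun p q => ?_
    have hl : (τ * jordanMatrix lam s) p q = d p * jordanMatrix lam s (σ p) q := by
      rw [Matrix.mul_apply, Finset.sum_eq_single (σ p)]
      · simp [τ]
      · intro r _ hr; simp [τ, hr.symm]
      · simp
    have hr : (jordanMatrix lam s * τ) p q = jordanMatrix lam s p (σ q) * d (σ q) := by
      rw [Matrix.mul_apply, Finset.sum_eq_single (σ q)]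
      · simp [τ, hσ]
      · intro r _ hr
        have : σ r ≠ q := fun h => hr (by rw [← h, hσ])
        simp [τ, this]
      · simp
    rw [Matrix.neg_apply, hl, hr, ← hd, ← hB p (σ q), hσ]
  · refine Matrix.ext fun p q => ?_
    rw [Matrix.mul_apply, Finset.sum_eq_single (σ p)]
    · simp only [τ, Matrix.of_apply, if_true, hσ, Matrix.diagonal_apply, ← hcc, mul_ite, mul_zero]
      congr 1
      change (-1) ^ (p.2 : ℕ) * c p.1 * ((-1) ^ (p.2 : ℕ) * c (π p.1)) = _
      rcases neg_one_pow_eq_or ℍ[ℝ] p.2 with h | h <;> rw [h] <;> simp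
    · intro r _ hr; simp [τ, hr.symm]
    · simp

/-! ### Assembling the involution. -/

theorem exists_involution_of_swap {R : Type*} [Ring R] {B G G' τ₀ Pp Pm P₀ : R}
    (hGG' : G * G' = 1) (hG'G : G' * G = 1) (hGB : G * B = -(B * G))
    (hPp : Pp * Pp = Pp) (hPm : Pm * Pm = Pm) (hpm : Pp * Pm = 0) (hmp : Pm * Pp = 0)
    (hsum : Pp + Pm + P₀ = 1) (hBp : Pp * B = B * Pp) (hBm : Pm * B = B * Pm)
    (hGp : G * Pp = Pm * G)     (hτB : τ₀ * B = -(B * τ₀)) (hττ : τ₀ * τ₀ = P₀) :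
    ∃ τ : R, τ * τ = 1 ∧ τ * B = -(B * τ) := by
  have hG'B : G' * B = -(B * G') := by
    have h : G' * (G * B) * G' = -(G' * (B * G) * G') := by rw [hGB]; noncomm_ring
    rw [← mul_assoc, hG'G, one_mul, mul_assoc, mul_assoc, hGG', mul_one] at h
    rw [h, neg_neg]
  have hG'm : G' * Pm = Pp * G' := by
    have h : G' * (Pm * G) * G' = G' * (G * Pp) * G' := by rw [hGp]
    rwa [← mul_assoc G' G, hG'G, one_mul, mul_assoc, mul_assoc, hGG', mul_one] at h
  have h₀ : P₀ = 1 - Pp - Pm := by rw [← hsum]; abel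
  have hp₀ : Pp * P₀ = 0 := by rw [h₀, mul_sub, mul_sub, mul_one, hPp, hpm]; abel
  have hm₀ : Pm * P₀ = 0 := by rw [h₀, mul_sub, mul_sub, mul_one, hPm, hmp]; abel
  have h₀p : P₀ * Pp = 0 := by rw [h₀, sub_mul, sub_mul, one_mul, hPp, hmp]; abel
  have h₀m : P₀ * Pm = 0 := by rw [h₀, sub_mul, sub_mul, one_mul, hPm, hpm]; abel
  have h₀₀ : P₀ * P₀ = P₀ := by
    nth_rewrite 1 [h₀]
    rw [sub_mul, sub_mul, one_mul, hp₀, hm₀, sub_zero, sub_zero]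
  have hB₀ : P₀ * B = B * P₀ := by
    rw [h₀, sub_mul, sub_mul, mul_sub, mul_sub, hBp, hBm, one_mul, mul_one]
  have hτ₀ : τ₀ * P₀ = P₀ * τ₀ := by rw [← hττ, mul_assoc]
  -- Using `G'` rather than `G` on the way back makes the square `1` without any condition on `G *
  -- G`.
  refine ⟨G * Pp + G' * Pm + τ₀ * P₀, ?_, ?_⟩
  · have e₁ : G * Pp * (G * Pp) = 0 := by
      rw [congrArg (G * Pp * ·) hGp, mul_assoc, ← mul_assoc Pp, hpm, zero_mul, mul_zero]
    have e₂ : G * Pp * (G' * Pm) = Pm := by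
      rw [hG'm, ← mul_assoc, mul_assoc G, hPp, hGp, mul_assoc, hGG', mul_one]
    have e₃ : G * Pp * (τ₀ * P₀) = 0 := by
      rw [hτ₀, mul_assoc, ← mul_assoc Pp, hp₀, zero_mul, mul_zero]
    have e₄ : G' * Pm * (G * Pp) = Pp := by
      rw [hGp, ← mul_assoc, mul_assoc G', hPm, hG'm, mul_assoc, hG'G, mul_one]
    have e₅ : G' * Pm * (G' * Pm) = 0 := by
      rw [congrArg (G' * Pm * ·) hG'm, mul_assoc, ← mul_assoc Pm, hmp, zero_mul, mul_zero]
    have e₆ : G' * Pm * (τ₀ * P₀) = 0 := by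
      rw [hτ₀, mul_assoc, ← mul_assoc Pm, hm₀, zero_mul, mul_zero]
    have e₇ : τ₀ * P₀ * (G * Pp) = 0 := by
      rw [hGp, mul_assoc, ← mul_assoc P₀, h₀m, zero_mul, mul_zero]
    have e₈ : τ₀ * P₀ * (G' * Pm) = 0 := by
      rw [hG'm, mul_assoc, ← mul_assoc P₀, h₀p, zero_mul, mul_zero]
    have e₉ : τ₀ * P₀ * (τ₀ * P₀) = P₀ := by
      nth_rewrite 2 [hτ₀]
      rw [mul_assoc, ← mul_assoc P₀, h₀₀, ← mul_assoc, hτ₀, mul_assoc, hττ, h₀₀]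
    simp only [add_mul, mul_add, e₁, e₂, e₃, e₄, e₅, e₆, e₇, e₈, e₉]
    rw [← hsum]
    abel
  · have e₁ : G * Pp * B = -(B * (G * Pp)) := by
      rw [mul_assoc, hBp, ← mul_assoc, hGB, neg_mul, mul_assoc]
    have e₂ : G' * Pm * B = -(B * (G' * Pm)) := by
      rw [mul_assoc, hBm, ← mul_assoc, hG'B, neg_mul, mul_assoc]
    have e₃ : τ₀ * P₀ * B = -(B * (τ₀ * P₀)) := by
      rw [mul_assoc, hB₀, ← mul_assoc, hτB, neg_mul, mul_assoc]
    rw [add_mul, add_mul, e₁, e₂, e₃]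
    noncomm_ring

theorem jordanMatrix_exists_involution {ι : Type*} [Fintype ι] [DecidableEq ι] (lam : ι → ℂ)
    (s : ι → ℕ)
    (h : ∀ μ m, μ ≠ 0 → μ.re = 0 → Even (Nat.card {l : ι // lam l = μ ∧ s l = m}))
    {G G' : Matrix (Σ l, Fin (s l)) (Σ l, Fin (s l)) ℍ[ℝ]} (hGG' : G * G' = 1)
    (hG : G * jordanMatrix lam s = -(jordanMatrix lam s * G)) :
    ∃ τ : Matrix (Σ l, Fin (s l)) (Σ l, Fin (s l)) ℍ[ℝ], τ * τ = 1 ∧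
      τ * jordanMatrix lam s = -(jordanMatrix lam s * τ) := by
  obtain ⟨τ₀, hτB, hττ⟩ := jordanMatrix_exists_partial_involution lam s h
  let Pp : Matrix (Σ l, Fin (s l)) (Σ l, Fin (s l)) ℍ[ℝ] :=
    Matrix.diagonal fun p => if 0 < (lam p.1).re then 1 else 0
  let Pm : Matrix (Σ l, Fin (s l)) (Σ l, Fin (s l)) ℍ[ℝ] :=
    Matrix.diagonal fun p => if (lam p.1).re < 0 then 1 else 0
  have hcomm : ∀ f : ι → ℍ[ℝ], (∀ l, f l = 0 ∨ f l = 1) →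
      Matrix.diagonal (fun p : Σ l, Fin (s l) => f p.1) * jordanMatrix lam s =
        jordanMatrix lam s * Matrix.diagonal fun p : Σ l, Fin (s l) => f p.1 := by
    intro f hf
    refine Matrix.ext fun p q => ?_
    rw [Matrix.diagonal_mul, Matrix.mul_diagonal]
    by_cases hpq : p.1 = q.1
    · rw [hpq]
      rcases hf q.1 with h | h <;> simp [h]
    · have : p ≠ q := fun h => hpq (h ▸ rfl)
      simp [jordanMatrix_apply, this, hpq]
  have hG0 : ∀ p q, G p q ≠ 0 → (lam p.1).re = -(lam q.1).re := fun p q h => by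
    by_contra hpq
    exact h (jordanMatrix_anticommute_apply_eq_zero hG hpq)
  refine exists_involution_of_swap (Pp := Pp) (Pm := Pm) hGG' (mul_eq_one_comm.1 hGG') hG
    ?_ ?_ ?_ ?_ ?_ ?_ ?_ ?_ hτB hττ
  · rw [Matrix.diagonal_mul_diagonal]; simp [Pp]
  · rw [Matrix.diagonal_mul_diagonal]; simp [Pm]
  · rw [Matrix.diagonal_mul_diagonal, ← Matrix.diagonal_zero]
    congr 1; funext p; split_ifs <;> first | (simp; done) | (exfalso; linarith)
  · rw [Matrix.diagonal_mul_diagonal, ← Matrix.diagonal_zero]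
    congr 1; funext p; split_ifs <;> first | (simp; done) | (exfalso; linarith)
  · rw [Matrix.diagonal_add, Matrix.diagonal_add, ← Matrix.diagonal_one]
    congr 1; funext p
    rcases lt_trichotomy (lam p.1).re 0 with h | h | h
    · simp [h, h.not_gt, h.ne]
    · simp [h]
    · simp [h, h.not_gt, h.ne']
  · exact hcomm (fun l => if 0 < (lam l).re then 1 else 0) fun l => by split_ifs <;> simp
  · exact hcomm (fun l => if (lam l).re < 0 then 1 else 0) fun l => by split_ifs <;> simp
  -- `G * Pp = Pm * G` holds entrywise: where `G p q ≠ 0`, the real part at `q` is positive exactly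
  -- when that at `p` is negative.
  · refine Matrix.ext fun p q => ?_
    rw [Matrix.diagonal_mul, Matrix.mul_diagonal]
    by_cases hpq : G p q = 0
    · simp [hpq]
    · simp [hG0 p q hpq]

theorem mainTheorem3 (n : ℕ) (A : GlH n) (hA : IsAdReal A)
    (hmult : ∀ (D : JordanDecomposition A) (μ : ℂ) (m : ℕ),
      μ ≠ 0 → μ.re = 0 → Even (D.multiplicity μ m)) :
    IsStronglyAdReal A := by
  obtain ⟨D⟩ := nonempty_jordanDecomposition A
  obtain ⟨g, hg⟩ := hA
  let φ : Matrix (Σ l, Fin (D.size l)) (Σ l, Fin (D.size l)) ℍ[ℝ] ≃+* GlH n :=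
    (Matrix.reindexAlgEquiv ℝ ℍ[ℝ] D.rows).toRingEquiv
  have hD : ∃ u : GroupGLH n, adjointAction u A = φ (jordanMatrix D.lam D.size) := ⟨D.S, D.eq_form⟩
  obtain ⟨u, hu⟩ := hD
  set B := jordanMatrix D.lam D.size with hB
  have hgA : (g : GlH n) * A = -(A * g) := by
    have h := congrArg (· * (g : GlH n)) hg
    simp only [adjointAction, Units.inv_mul_cancel_right, neg_mul] at h
    exact h.symm
  have huA : (u : GlH n) * A = φ B * u := by
    rw [← hu, adjointAction, Units.inv_mul_cancel_right]
  have hA' : A * ((u⁻¹ : GroupGLH n) : GlH n) = ((u⁻¹ : GroupGLH n) : GlH n) * φ B := by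
    rw [Units.eq_inv_mul_iff_mul_eq, ← mul_assoc, huA, Units.mul_inv_cancel_right]
  have hconj : ((u * g * u⁻¹ : GroupGLH n) : GlH n) * φ B =
      -(φ B * ((u * g * u⁻¹ : GroupGLH n) : GlH n)) := by
    rw [Units.val_mul, Units.val_mul, mul_assoc, ← hA', ← mul_assoc, mul_assoc (u : GlH n), hgA,
      mul_neg, ← mul_assoc, huA]
    noncomm_ring
  obtain ⟨τ, hτ, hτB⟩ := jordanMatrix_exists_involution D.lam D.size (hmult D)
    (G := φ.symm ((u * g * u⁻¹ : GroupGLH n) : GlH n))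
    (G' := φ.symm (((u * g * u⁻¹)⁻¹ : GroupGLH n) : GlH n))
    (by rw [← map_mul, Units.mul_inv, map_one])
    (by
      apply φ.injective
      rw [map_mul, map_neg, map_mul, RingEquiv.apply_symm_apply]
      exact hconj)
  have hφτ : φ τ * φ τ = 1 := by rw [← map_mul, hτ, map_one]
  have hφτB : φ τ * φ B = -(φ B * φ τ) := by rw [← map_mul, hτB, map_neg, map_mul]
  let t : GroupGLH n := ⟨φ τ, φ τ, hφτ, hφτ⟩
  have ht : t * t = 1 := Units.ext hφτ
  have hw : u⁻¹ * t * u * (u⁻¹ * t * u) = 1 := by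
    rw [show u⁻¹ * t * u * (u⁻¹ * t * u) = u⁻¹ * (t * t) * u by group, ht, mul_one,
      inv_mul_cancel]
  refine ⟨u⁻¹ * t * u, hw, ?_⟩
  rw [adjointAction, Units.eq_mul_inv_iff_mul_eq, Units.val_mul, Units.val_mul]
  change -A * (((u⁻¹ : GroupGLH n) : GlH n) * φ τ * u) = ((u⁻¹ : GroupGLH n) : GlH n) * φ τ * u * A
  rw [mul_assoc _ (u : GlH n) A, huA, ← mul_assoc _ (φ B), mul_assoc _ (φ τ) (φ B), hφτB, mul_neg,
    ← mul_assoc _ (φ B), ← hA']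
  noncomm_ring
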